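/- Let $k$ be a field and let $H=\langle a_1,a_2,\ldots,a_n\rangle\subseteq\mathbb{N}$ be a numerical semigroup (that is, $\mathbb{N}\setminus H$ is finite) whose embedding dimension (the least number of generators of $H$) is $n\ge 3$ and whose multiplicity $\min(H\setminus\{0\})$ is $a_1\ge 3$. Let $k[H]=k[t^{a_1},\ldots,t^{a_n}]\subseteq k[t]$, let $S=k[X_1,\ldots,X_n]$, and let $I_H$ be the kernel of the $k$-algebra homomorphism $S\to k[H]$, $X_i\mapsto t^{a_i}$. Put $$\operatorname{PF}(H)=\{z\in\mathbb{Z}\setminus H \mid z+x\in H \text{ for all } 0<x\in H\}.$$ Suppose that $k[H]/(t^{a_1})$ is stretched, i.e. it is an Artinian local ring whose maximal ideal $\mathfrak m$ satisfies $\mathfrak m^2=(0)$ or $\mathfrak m^2$ is principal, and that $$\operatorname{PF}(H)=\{h+\alpha,\,h+2\alpha,\,\ldots,\,h+(n-1)\alpha\}$$ for some integers $h\ge 0$ and $\alpha>0$. Then, after a suitable permutation of $a_2,\ldots,a_n$ (with the variables $X_2,\ldots,X_n$ of $S$ corresponding to the permuted generators), there are positive integers $h_1,\ell,p$ such that $$I_H=\operatorname{I}_2\begin{pmatrix}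 X_1^{h_1} & X_2^{\ell} & X_3 & \cdots & X_{n-1} & X_n\\ X_2 & X_3 & X_4 & \cdots & X_n & X_1^{p}\end{pmatrix},$$ where $\operatorname{I}_2(M)$ denotes the ideal of $S$ generated by the $2\times 2$ minors of the matrix $M$. (For $n=3$ the matrix is $\begin{pmatrix} X_1^{h_1} & X_2^{\ell} & X_3\\ X_2 & X_3 & X_1^{p}\end{pmatrix}$.) -/

import Mathlib

open Polynomial

/-- The submonoid `⟨a_1, …, a_n⟩` of `ℕ`; the family is indexed by `Fin n`, so that `a_1` is `a 0`. -/
def genSemigroup {n : ℕ} (a : Fin n → ℕ) : AddSubmonoid ℕ :=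
  AddSubmonoid.closure (Set.range a)

/-- A numerical semigroup is a submonoid of `ℕ` with finite complement. -/
def IsNumericalSemigroup (H : AddSubmonoid ℕ) : Prop :=
  ((H : Set ℕ)ᶜ).Finite

/-- The embedding dimension of `H`: the least number of elements generating `H`. -/
noncomputable def embDim (H : AddSubmonoid ℕ) : ℕ :=
  sInf {m : ℕ | ∃ s : Finset ℕ, s.card = m ∧ AddSubmonoid.closure (s : Set ℕ) = H}

/-- `m` is the multiplicity of `H`, that is, `m = min (H \ {0})`. -/
def IsMultiplicity (H : AddSubmonoid ℕ) (m : ℕ) : Prop :=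
  IsLeast {x : ℕ | x ∈ H ∧ x ≠ 0} m

/-- `H` regarded as a submonoid of `ℤ`. -/
def intSemigroup (H : AddSubmonoid ℕ) : AddSubmonoid ℤ :=
  H.map (Nat.castAddMonoidHom ℤ)

/-- The set of pseudo-Frobenius numbers: integers `z ∉ H` with `z + x ∈ H` for all `0 < x ∈ H`. -/
def pseudoFrobenius (H : AddSubmonoid ℕ) : Set ℤ :=
  {z : ℤ | z ∉ intSemigroup H ∧ ∀ x ∈ intSemigroup H, 0 < x → z + x ∈ intSemigroup H}

/-- The semigroup ring `k[H] = k[t^{a_1}, …, t^{a_n}] ⊆ k[t]` of `H = ⟨a_1, …, a_n⟩`. -/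
noncomputable def semigroupRing (k : Type*) [Field k] {n : ℕ} (a : Fin n → ℕ) :
    Subalgebra k k[X] :=
  Algebra.adjoin k (Set.range fun i => (X : k[X]) ^ a i)

/-- The element `t^{a_i}` of `k[H]`. -/
noncomputable def tPow (k : Type*) [Field k] {n : ℕ} (a : Fin n → ℕ) (i : Fin n) :
    semigroupRing k a :=
  ⟨(X : k[X]) ^ a i, Algebra.subset_adjoin ⟨i, rfl⟩⟩

/-- The `k`-algebra map `φ_H : k[X_1, …, X_n] → k[H]`, `X_i ↦ t^{a_i}`. -/
noncomputable def semigroupRingMap (k : Type*) [Field k] {n : ℕ} (a : Fin n → ℕ) :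
    MvPolynomial (Fin n) k →ₐ[k] semigroupRing k a :=
  MvPolynomial.aeval (tPow k a)

/-- The defining ideal `I_H = Ker φ_H`. -/
noncomputable def definingIdeal (k : Type*) [Field k] {n : ℕ} (a : Fin n → ℕ) :
    Ideal (MvPolynomial (Fin n) k) :=
  RingHom.ker (semigroupRingMap k a)

/-- An Artinian local ring with maximal ideal `𝔪` is stretched if `𝔪² = 0` or `𝔪²` is principal. -/
def IsStretched (A : Type*) [CommRing A] : Prop :=
  IsArtinianRing A ∧ ∃ _ : IsLocalRing A,
    IsLocalRing.maximalIdeal A ^ 2 = ⊥ ∨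
      (IsLocalRing.maximalIdeal A ^ 2).IsPrincipal

/-- The ideal `I_t(M)` generated by the `t × t` minors of the matrix `M`. -/
def minorsIdeal {R : Type*} [CommRing R] {p q : ℕ} (t : ℕ) (M : Matrix (Fin p) (Fin q) R) :
    Ideal R :=
  Ideal.span {f : R | ∃ (r : Fin t ↪o Fin p) (c : Fin t ↪o Fin q), f = (M.submatrix r c).det}

/-- The matrix with rows `X_1^e, X_2^ℓ, X_3, …, X_n` and `X_2, X_3, …, X_n, X_1^p`
(where `X_1` is `X 0`, `X_2` is `X 1`, and so on). -/
noncomputable def curveMatrix (k : Type*) [Field k] (n : ℕ) [NeZero n] (e ℓ p : ℕ) :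
    Matrix (Fin 2) (Fin n) (MvPolynomial (Fin n) k) :=
  Matrix.of ![
    fun i => if i.val = 0 then MvPolynomial.X 0 ^ e
      else if i.val = 1 then MvPolynomial.X i ^ ℓ
      else MvPolynomial.X i,
    fun i => if hi : i.val + 1 < n then MvPolynomial.X ⟨i.val + 1, hi⟩
      else MvPolynomial.X 0 ^ p]

/-! Everything is read off from the Apéry set of `H` with respect to `a 0`, which has exactly one
element in each class of `ZMod (a 0)`.

Modulo `t^{a 0}`, stretchedness makes the square of the maximal ideal generated by one product of
two generators (Nakayama), so every Apéry element that is a sum of at least two generators lies in a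
single `a i + a j + H` (`IsStretched.exists_add_mem`). Shifting the `n - 1` pseudo-Frobenius numbers
by `a 0` gives as many maximal Apéry elements. Counting then forces the Apéry set to consist of a
chain `0, a q, …, s * a q` and the other generators, with `s * a q` and those generators as the
shifted numbers (`apery_structure`).

Those shifted numbers form an arithmetic progression of difference `α`, so the cyclic group `ZMod (a
0)` is cut into a progression of step `a q` and one of step `α`. This is possible only if `a q` is
congruent to `α` or `-α` (`eq_or_eq_neg_of_partition`). Listing the generators along the progression
in the matching direction makes the two entries of each column of the matrix differ by the same
degree.

The minors therefore vanish on the curve. Conversely, modulo the minors every monomial reduces to a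
power of `X_1` times a monomial standing for an Apéry element, and such normal forms are told apart
by degree (`definingIdeal_eq_minorsIdeal`). -/

/-! ### Two progressions partitioning an abelian group -/

/-- A partition of an abelian group into an initial segment `0, a, …, (s - 1) a` and a segment
`x + α, …, x + N α` containing `s a` forces `a = ± α`. -/
theorem eq_or_eq_neg_of_partition {G : Type*} [AddCommGroup G] {a x α : G} {s N c : ℕ}
    (hN : 2 ≤ N) (hs : 2 ≤ s ∨ s = 1 ∧ c = 1)
    (hcover : ∀ g : G, (∃ j < s, g = j • a) ∨ ∃ i, 1 ≤ i ∧ i ≤ N ∧ g = x + i • α)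
    (hdisj : ∀ j < s, ∀ i, 1 ≤ i → i ≤ N → j • a ≠ x + i • α)
    (hinj : ∀ i i', 1 ≤ i → i ≤ N → 1 ≤ i' → i' ≤ N → x + i • α = x + i' • α → i = i')
    (hc1 : 1 ≤ c) (hcN : c ≤ N) (hc : s • a = x + c • α) :
    (a = -α ∧ x = 0 ∧ c = N) ∨ (a = α ∧ c = 1 ∧ x + (N + 1) • α = 0) := by
  have hα : α ≠ 0 := by
    rintro rfl
    have := hinj 1 2 le_rfl (by omega) (by omega) hN (by simp)
    omega
  have ha0 : a ≠ 0 := by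
    rintro rfl
    exact hdisj 0 (by omega) c hc1 hcN (by rw [← hc]; simp)
  -- leaving the first segment by a step `α` is possible only from `x`
  have hleave : ∀ j < s, (∃ i, 1 ≤ i ∧ i ≤ N ∧ j • a + α = x + i • α) → j • a = x := by
    rintro j hj ⟨i, hi1, hiN, h⟩
    obtain ⟨i, rfl⟩ : ∃ i', i = i' + 1 := ⟨i - 1, by omega⟩
    rw [succ_nsmul, ← add_assoc] at h
    have h' := add_right_cancel h
    rcases Nat.eq_zero_or_pos i with rfl | hi
    · simpa using h'
    · exact absurd h' (hdisj j hj i hi (by omega))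
  -- Step back by `α` from `x + (N + 1) • α`: unless this element is `0`, its predecessor `x + N •
  -- α` would lie in the first segment or repeat an earlier term of the second.
  have hend : a = α → c = 1 → x + (N + 1) • α = 0 := by
    rintro rfl rfl
    have hs' : s • a = x + a := by simpa using hc
    rcases hcover (x + (N + 1) • a) with ⟨j, hj, h⟩ | ⟨i, hi1, hiN, h⟩
    · rcases Nat.eq_zero_or_pos j with rfl | hj0
      · simpa using h
      · obtain ⟨j, rfl⟩ : ∃ j', j = j' + 1 := ⟨j - 1, by omega⟩
        rw [succ_nsmul, succ_nsmul, ← add_assoc] at h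
        exact absurd (add_right_cancel h).symm (hdisj j (by omega) N (by omega) le_rfl)
    · obtain ⟨i, rfl⟩ : ∃ i', i = i' + 1 := ⟨i - 1, by omega⟩
      rw [succ_nsmul, succ_nsmul, ← add_assoc, ← add_assoc] at h
      have h' := add_right_cancel h
      rcases Nat.eq_zero_or_pos i with rfl | hi
      · obtain ⟨s, rfl⟩ : ∃ s', s = s' + 1 := ⟨s - 1, by omega⟩
        rw [succ_nsmul] at hs'
        have h2 := add_right_cancel hs'
        rw [zero_nsmul, add_zero] at h'
        exact absurd (h2.trans h'.symm) (hdisj s (by omega) N (by omega) le_rfl)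
      · have := hinj N i (by omega) le_rfl hi (by omega) h'
        omega
  by_cases hx : x = 0
  · subst hx
    rcases hs with hs | ⟨rfl, rfl⟩
    · left
      have haα : a = -α := by
        by_contra hne
        rcases hcover (a + α) with ⟨j, hj, h⟩ | ⟨i, hi1, hiN, h⟩
        · rcases Nat.eq_zero_or_pos j with rfl | hj0
          · exact hne (eq_neg_of_add_eq_zero_left (by simpa using h))
          · obtain ⟨j, rfl⟩ : ∃ j', j = j' + 1 := ⟨j - 1, by omega⟩
            rw [succ_nsmul, add_comm] at h
            exact hdisj j (by omega) 1 le_rfl (by omega) (by simpa using (add_right_cancel h).symm)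
        · exact ha0 (by simpa using hleave 1 (by omega) ⟨i, hi1, hiN, by simpa using h⟩)
      refine ⟨haα, rfl, ?_⟩
      by_contra hne
      refine hdisj (s - 1) (by omega) (c + 1) (by omega) (by omega) ?_
      obtain ⟨s, rfl⟩ : ∃ s', s = s' + 1 := ⟨s - 1, by omega⟩
      rw [succ_nsmul, ← add_assoc, ← hc, succ_nsmul, haα]
      simp
    · have haα : a = α := by simpa using hc
      exact Or.inr ⟨haα, rfl, hend haα rfl⟩
  · right
    -- If `α` were in the second segment, the step from `0` to `α` would leave the first one,
    -- forcing `x = 0`.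
    rcases hcover α with ⟨j, hj, h⟩ | hP
    · have hj0 : 0 < j := Nat.pos_of_ne_zero (by rintro rfl; exact hα (by simpa using h))
      have hsj : (s - j) • a + α = s • a := by
        rw [h, ← add_nsmul, Nat.sub_add_cancel hj.le]
      have hxe := hleave (s - j) (by omega) ⟨c, hc1, hcN, hsj.trans hc⟩
      have hx1 : s • a = x + 1 • α := by rw [← hsj, hxe, one_nsmul]
      have hc' : c = 1 := hinj c 1 hc1 hcN le_rfl (by omega) (hc.symm.trans hx1)
      -- `x + 2 α - a` lies in the second segment
      have h2 : (s - 1) • a + α = x + 2 • α - a := by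
        obtain ⟨s, rfl⟩ : ∃ s', s = s' + 1 := ⟨s - 1, by omega⟩
        have : s • a = x + 1 • α - a := by rw [← hx1, succ_nsmul]; simp
        simp only [Nat.add_sub_cancel, this, two_nsmul, one_nsmul]
        abel
      have haα : a = α := by
        rcases hcover (x + 2 • α - a) with ⟨i, hi, h'⟩ | hP
        · exfalso
          have h3 : (i + 1) • a = x + 2 • α := by rw [succ_nsmul, ← h']; abel
          rcases Nat.lt_or_ge (i + 1) s with hlt | hge
          · exact hdisj (i + 1) hlt 2 (by omega) hN h3
          · obtain rfl : i + 1 = s := by omega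
            have := hinj 1 2 le_rfl (by omega) (by omega) hN (hx1.symm.trans h3)
            omega
        · have h3 := hleave (s - 1) (by omega) (by rwa [h2])
          rw [h3] at h2
          have h4 : a = x + 2 • α - (x + α) := by rw [h2]; abel
          rw [h4, two_nsmul]; abel
      exact ⟨haα, hc', hend haα hc'⟩
    · exact absurd (by simpa using hleave 0 (by omega) (by simpa using hP)) (Ne.symm hx)

/-! ### Stretchedness in terms of sums of generators -/

theorem mem_of_coeff_ne_zero {k : Type*} [Field k] {n : ℕ} {a : Fin n → ℕ} {f : k[X]}
    (hf : f ∈ semigroupRing k a) : ∀ {d : ℕ}, f.coeff d ≠ 0 → d ∈ genSemigroup a := by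
  induction hf using Algebra.adjoin_induction with
  | mem x hx =>
    obtain ⟨i, rfl⟩ := hx
    intro d hd
    rw [coeff_X_pow] at hd
    have : d = a i := by by_contra h; simp [h] at hd
    exact this ▸ AddSubmonoid.subset_closure ⟨i, rfl⟩
  | algebraMap r =>
    intro d hd
    rw [Polynomial.algebraMap_apply, coeff_C] at hd
    have : d = 0 := by by_contra h; simp [h] at hd
    exact this ▸ zero_mem _
  | add x y _ _ hx hy =>
    intro d hd
    rw [coeff_add] at hd
    by_cases h : x.coeff d = 0
    · exact hy (by rwa [h, zero_add] at hd)
    · exact hx h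
  | mul x y _ _ hx hy =>
    intro d hd
    rw [coeff_mul] at hd
    obtain ⟨p, hp, hne⟩ := Finset.exists_ne_zero_of_sum_ne_zero hd
    rw [← Finset.HasAntidiagonal.mem_antidiagonal.1 hp]
    exact add_mem (hx (left_ne_zero_of_mul hne)) (hy (right_ne_zero_of_mul hne))

theorem exists_sub_algebraMap_mem_span {k : Type*} [Field k] {n : ℕ} (a : Fin n → ℕ)
    (r : semigroupRing k a) :
    ∃ c : k, r - algebraMap k _ c ∈ Ideal.span (Set.range (tPow k a)) := by
  obtain ⟨f, hf⟩ := r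
  induction hf using Algebra.adjoin_induction with
  | mem x hx =>
    obtain ⟨i, rfl⟩ := hx
    exact ⟨0, by rw [map_zero, sub_zero]; exact Ideal.subset_span (Set.mem_range_self i)⟩
  | algebraMap r =>
    exact ⟨r, by convert Ideal.zero_mem _ using 1; exact sub_eq_zero.2 rfl⟩
  | add x y hx' hy' hx hy =>
    obtain ⟨c, hc⟩ := hx
    obtain ⟨d, hd⟩ := hy
    refine ⟨c + d, ?_⟩
    convert add_mem hc hd using 1
    rw [map_add, sub_add_sub_comm]
    rfl
  | mul x y hx' hy' hx hy =>
    obtain ⟨c, hc⟩ := hx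
    obtain ⟨d, hd⟩ := hy
    refine ⟨c * d, ?_⟩
    convert add_mem (Ideal.mul_mem_right (⟨y, hy'⟩ : semigroupRing k a) _ hc)
      (Ideal.mul_mem_left _ (algebraMap k _ c) hd) using 1
    rw [map_mul]
    have : (⟨x * y, mul_mem hx' hy'⟩ : semigroupRing k a) = ⟨x, hx'⟩ * ⟨y, hy'⟩ := rfl
    rw [this]
    ring

open scoped Pointwise in
/-- The square of the maximal ideal of a local ring, if principal, is generated by a product of
two members of any given nonempty generating set of the maximal ideal. -/
theorem exists_sq_maximalIdeal_eq_span_mul {A : Type*} [CommRing A] [IsLocalRing A] {T : Set A}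
    (hT : T.Nonempty) (hspan : IsLocalRing.maximalIdeal A = Ideal.span T)
    (h : (IsLocalRing.maximalIdeal A ^ 2).IsPrincipal) :
    ∃ u ∈ T, ∃ v ∈ T, IsLocalRing.maximalIdeal A ^ 2 = Ideal.span {u * v} := by
  set M := IsLocalRing.maximalIdeal A with hM
  have hsq : M ^ 2 = Ideal.span (T * T) := by rw [pow_two, hspan, Ideal.span_mul_span']
  by_cases hbot : M ^ 2 = ⊥
  · obtain ⟨u, hu⟩ := hT
    refine ⟨u, hu, u, hu, ?_⟩
    have : u * u ∈ M ^ 2 := hsq ▸ Ideal.subset_span (Set.mul_mem_mul hu hu)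
    rw [hbot, Ideal.mem_bot] at this
    rw [hbot, this, Ideal.span_singleton_zero]
  obtain ⟨g, hg⟩ := h
  rw [Ideal.submodule_span_eq] at hg
  -- If no product generates, each is a multiple `r * g` with `r` a nonunit, so `M ^ 2 ≤ M • M ^ 2`
  -- and Nakayama gives `M ^ 2 = ⊥`.
  by_contra! hcon
  refine hbot (Submodule.eq_bot_of_le_smul_of_le_jacobson_bot M (M ^ 2) ?_ ?_
    (IsLocalRing.maximalIdeal_le_jacobson ⊥))
  · rw [hg]; exact ⟨{g}, by simp⟩
  · conv_lhs => rw [hsq]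
    rw [Ideal.span_le]
    rintro _ ⟨u, hu, v, hv, rfl⟩
    have huv : u * v ∈ M ^ 2 := hsq ▸ Ideal.subset_span (Set.mul_mem_mul hu hv)
    rw [hg, Ideal.mem_span_singleton'] at huv
    obtain ⟨r, hr⟩ := huv
    change u * v ∈ _
    rw [← hr]
    have hgm : g ∈ M ^ 2 := hg ▸ Ideal.mem_span_singleton_self g
    by_cases hrM : r ∈ M
    · exact Ideal.mul_mem_mul hrM hgm
    · have hru : IsUnit r := by simpa [hM] using hrM
      refine absurd ?_ (hcon u hu v hv)
      rw [hg, ← hr, Ideal.span_singleton_mul_left_unit hru]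

/-- The classes of `t^{a i}`, `i ≠ 0`, generate the maximal ideal, so one product of two of them
generates its square. Lifting the resulting divisibility to `k[X]` and looking at a single
coefficient turns it into a statement about `H`. -/
theorem IsStretched.exists_add_mem {k : Type*} [Field k] {n : ℕ} [NeZero n] (hn : 2 ≤ n)
    {a : Fin n → ℕ} (ha : ∀ i, a i ≠ 0)
    (hstr : IsStretched (semigroupRing k a ⧸ Ideal.span {tPow k a 0})) :
    ∃ i ≠ 0, ∃ j ≠ 0, ∀ u v, u ≠ 0 → v ≠ 0 →
      (∃ y ∈ genSemigroup a, a u + a v = a 0 + y) ∨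
      ∃ y ∈ genSemigroup a, a u + a v = a i + a j + y := by
  obtain ⟨-, hloc, hM⟩ := hstr
  set I : Ideal (semigroupRing k a) := Ideal.span {tPow k a 0} with hI
  set τ : Fin n → semigroupRing k a ⧸ I := fun i => Ideal.Quotient.mk I (tPow k a i) with hτ
  have hτ0 : τ 0 = 0 := Ideal.Quotient.eq_zero_iff_mem.2 (Ideal.mem_span_singleton_self _)
  have hτM : ∀ i, τ i ∈ IsLocalRing.maximalIdeal (semigroupRing k a ⧸ I) := by
    intro i
    -- `τ i` is nilpotent because `(t^{a i})^{a 0} = (t^{a 0})^{a i}`.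
    have hpow : τ i ^ a 0 = 0 := by
      have : tPow k a i ^ a 0 = tPow k a 0 ^ a i := by
        apply Subtype.ext
        simp [tPow, ← pow_mul, mul_comm]
      rw [hτ, ← map_pow, this, map_pow]
      exact (congrArg (· ^ a i) hτ0).trans (zero_pow (ha i))
    rw [IsLocalRing.mem_maximalIdeal, mem_nonunits_iff]
    intro hu
    exact (hu.pow (a 0)).ne_zero hpow
  have hspan : IsLocalRing.maximalIdeal (semigroupRing k a ⧸ I) =
      Ideal.span (τ '' {i | i ≠ 0}) := by
    apply le_antisymm
    · intro x hx
      obtain ⟨r, rfl⟩ := Ideal.Quotient.mk_surjective x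
      obtain ⟨c, hc⟩ := exists_sub_algebraMap_mem_span a r
      have hmem : Ideal.Quotient.mk I (r - algebraMap k _ c) ∈ Ideal.span (τ '' {i | i ≠ 0}) := by
        have := Ideal.mem_map_of_mem (Ideal.Quotient.mk I) hc
        rw [Ideal.map_span] at this
        refine Ideal.span_le.2 ?_ this
        rintro _ ⟨_, ⟨i, rfl⟩, rfl⟩
        by_cases hi : i = 0
        · subst hi
          change τ 0 ∈ _
          rw [hτ0]; exact zero_mem _
        · exact Ideal.subset_span ⟨i, hi, rfl⟩
      have hle : Ideal.span (τ '' {i | i ≠ 0}) ≤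
          IsLocalRing.maximalIdeal (semigroupRing k a ⧸ I) :=
        Ideal.span_le.2 (by rintro _ ⟨i, -, rfl⟩; exact hτM i)
      by_cases hc0 : c = 0
      · simpa [hc0] using hmem
      · exfalso
        have h1 := sub_mem hx (hle hmem)
        rw [← map_sub, sub_sub_cancel] at h1
        rw [IsLocalRing.mem_maximalIdeal, mem_nonunits_iff] at h1
        exact h1 (((Ne.isUnit hc0).map (algebraMap k _)).map _)
    · exact Ideal.span_le.2 (by rintro _ ⟨i, -, rfl⟩; exact hτM i)
  have hone : (⟨1, by omega⟩ : Fin n) ≠ 0 := by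
    intro h; simpa using congrArg Fin.val h
  have hprin : (IsLocalRing.maximalIdeal (semigroupRing k a ⧸ I) ^ 2).IsPrincipal := by
    rcases hM with h | h
    · rw [h]; infer_instance
    · exact h
  obtain ⟨_, ⟨i, hi, rfl⟩, _, ⟨j, hj, rfl⟩, hsq⟩ :=
    exists_sq_maximalIdeal_eq_span_mul (Set.image_nonempty.2 ⟨_, hone⟩) hspan hprin
  refine ⟨i, hi, j, hj, fun u v hu hv => ?_⟩
  have huv : τ u * τ v ∈ IsLocalRing.maximalIdeal (semigroupRing k a ⧸ I) ^ 2 := by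
    rw [pow_two]; exact Ideal.mul_mem_mul (hτM u) (hτM v)
  rw [hsq, Ideal.mem_span_singleton'] at huv
  obtain ⟨x, hx⟩ := huv
  obtain ⟨g, rfl⟩ := Ideal.Quotient.mk_surjective x
  simp only [hτ, ← map_mul] at hx
  rw [eq_comm, Ideal.Quotient.eq, Ideal.mem_span_singleton'] at hx
  obtain ⟨f, hf⟩ := hx
  have hpoly : (X : k[X]) ^ (a u + a v) = f.1 * X ^ a 0 + g.1 * X ^ (a i + a j) := by
    have := congrArg Subtype.val hf
    simp only [tPow, AddSubgroupClass.coe_sub, MulMemClass.coe_mul] at this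
    rw [pow_add, pow_add, this]
    ring
  have hco := congrArg (fun q => coeff q (a u + a v)) hpoly
  simp only [coeff_X_pow_self, coeff_add, coeff_mul_X_pow'] at hco
  by_cases h1 : a 0 ≤ a u + a v ∧ f.1.coeff (a u + a v - a 0) ≠ 0
  · exact Or.inl ⟨_, mem_of_coeff_ne_zero f.2 h1.2, by omega⟩
  by_cases h2 : a i + a j ≤ a u + a v ∧ g.1.coeff (a u + a v - (a i + a j)) ≠ 0
  · exact Or.inr ⟨_, mem_of_coeff_ne_zero g.2 h2.2, by omega⟩
  exfalso
  split_ifs at hco <;> simp_all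

/-! ### Minimality of the generators -/

theorem gen_mem {n : ℕ} (a : Fin n → ℕ) (i : Fin n) : a i ∈ genSemigroup a :=
  AddSubmonoid.subset_closure ⟨i, rfl⟩

theorem eq_zero_or_exists_eq_gen_add {n : ℕ} {a : Fin n → ℕ} {y : ℕ} (hy : y ∈ genSemigroup a) :
    y = 0 ∨ ∃ i, ∃ z ∈ genSemigroup a, y = a i + z := by
  induction hy using AddSubmonoid.closure_induction with
  | mem x hx =>
    obtain ⟨i, rfl⟩ := hx
    exact Or.inr ⟨i, 0, zero_mem _, rfl⟩
  | zero => exact Or.inl rfl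
  | add x y hx hy ihx ihy =>
    rcases ihx with rfl | ⟨i, z, hz, rfl⟩
    · simpa using ihy
    · exact Or.inr ⟨i, z + y, add_mem hz hy, add_assoc _ _ _⟩

/-- A sum of naturals smaller than `c` cannot use `c` as a summand. -/
theorem mem_closure_diff_singleton_of_lt {S : Set ℕ} {y c : ℕ} (hy : y ∈ AddSubmonoid.closure S)
    (hlt : y < c) : y ∈ AddSubmonoid.closure (S \ {c}) := by
  induction hy using AddSubmonoid.closure_induction with
  | mem x hx => exact AddSubmonoid.subset_closure ⟨hx, hlt.ne⟩
  | zero => exact zero_mem _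
  | add x y _ _ ihx ihy => exact add_mem (ihx (by omega)) (ihy (by omega))

theorem embDim_le_card {H : AddSubmonoid ℕ} (s : Finset ℕ)
    (hs : AddSubmonoid.closure (s : Set ℕ) = H) : embDim H ≤ s.card :=
  Nat.sInf_le ⟨s, rfl, hs⟩

theorem injective_of_embDim_eq {n : ℕ} {a : Fin n → ℕ} (h : embDim (genSemigroup a) = n) :
    Function.Injective a := by
  have h1 := embDim_le_card (H := genSemigroup a) (Finset.univ.image a)
    (by simp [genSemigroup])
  have h2 : (Finset.univ.image a).card = (Finset.univ : Finset (Fin n)).card :=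
    le_antisymm Finset.card_image_le (by simpa [h] using h1)
  have h3 := Finset.card_image_iff.1 h2
  simpa using h3

theorem gen_notMem_closure_of_embDim_eq {n : ℕ} {a : Fin n → ℕ}
    (h : embDim (genSemigroup a) = n) (i : Fin n) :
    a i ∉ AddSubmonoid.closure (Set.range a \ {a i}) := by
  intro hmem
  have h1 := embDim_le_card (H := genSemigroup a) ((Finset.univ.image a).erase (a i)) <| by
    simp only [Finset.coe_erase, Finset.coe_image, Finset.coe_univ, Set.image_univ]
    refine le_antisymm (AddSubmonoid.closure_mono Set.sdiff_subset)
      (AddSubmonoid.closure_le.2 fun x hx => ?_)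
    by_cases hxi : x = a i
    · exact hxi ▸ hmem
    · exact AddSubmonoid.subset_closure ⟨hx, hxi⟩
  have h2 := Finset.card_erase_lt_of_mem (Finset.mem_image_of_mem a (Finset.mem_univ i))
  have h3 : (Finset.univ.image a).card ≤ n := by
    simpa using Finset.card_image_le (f := a) (s := Finset.univ)
  omega

theorem gen_ne_zero_of_embDim_eq {n : ℕ} {a : Fin n → ℕ}
    (h : embDim (genSemigroup a) = n) (i : Fin n) : a i ≠ 0 := by
  intro h0
  exact gen_notMem_closure_of_embDim_eq h i (h0 ▸ zero_mem _)

theorem gen_ne_add_of_embDim_eq {n : ℕ} {a : Fin n → ℕ}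
    (h : embDim (genSemigroup a) = n) (i : Fin n) {u v : ℕ} (hu : u ∈ genSemigroup a)
    (hv : v ∈ genSemigroup a) (hu0 : u ≠ 0) (hv0 : v ≠ 0) : a i ≠ u + v := by
  intro heq
  apply gen_notMem_closure_of_embDim_eq h i
  have h1 := mem_closure_diff_singleton_of_lt (c := a i) hu (by omega)
  have h2 := mem_closure_diff_singleton_of_lt (c := a i) hv (by omega)
  have h3 := add_mem h1 h2
  rwa [← heq] at h3

/-! ### Structure of the Apéry set -/

/-- `y` belongs to the Apéry set of `H` with respect to `m`. -/
def IsApery (H : AddSubmonoid ℕ) (m y : ℕ) : Prop :=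
  y ∈ H ∧ ∀ z ∈ H, y ≠ m + z

namespace IsApery

variable {H : AddSubmonoid ℕ} {m y z : ℕ}

theorem of_add (h : IsApery H m (y + z)) (hy : y ∈ H) (hz : z ∈ H) : IsApery H m y :=
  ⟨hy, fun w hw hyw => h.2 (w + z) (add_mem hw hz) (by rw [hyw, add_assoc])⟩

/-- Congruent elements differ by a multiple of `m`, so the larger would be `m` plus an element of
`H`. -/
theorem eq_of_natCast_eq (hm : m ∈ H) (hy : IsApery H m y) (hz : IsApery H m z)
    (h : (y : ZMod m) = z) : y = z := by
  have key : ∀ {y z : ℕ}, IsApery H m y → IsApery H m z → (y : ZMod m) = z → ¬ y < z := by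
    intro y z hy hz h hlt
    rw [ZMod.natCast_eq_natCast_iff] at h
    obtain ⟨t, ht⟩ := (Nat.modEq_iff_dvd' hlt.le).1 h
    obtain ⟨t, rfl⟩ : ∃ t', t = t' + 1 := ⟨t - 1, by
      rcases Nat.eq_zero_or_pos t with rfl | h0 <;> omega⟩
    refine hz.2 (t • m + y) (add_mem (nsmul_mem hm t) hy.1) ?_
    rw [smul_eq_mul]
    have : m * (t + 1) = t * m + m := by ring
    omega
  exact le_antisymm (not_lt.1 (key hz hy h.symm)) (not_lt.1 (key hy hz h))

end IsApery

theorem exists_isApery_natCast_eq {H : AddSubmonoid ℕ} (hH : IsNumericalSemigroup H) {m : ℕ}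
    (hm : m ≠ 0) (g : ZMod m) : ∃ y, IsApery H m y ∧ (y : ZMod m) = g := by
  have : NeZero m := ⟨hm⟩
  have hex : ∃ y, y ∈ H ∧ (y : ZMod m) = g := by
    obtain ⟨B, hB⟩ := hH.bddAbove
    -- A representative beyond the bound `B` on the gaps of `H`.
    refine ⟨g.val + m * (B + 1), ?_, by simp⟩
    by_contra hcon
    have h1 : g.val + m * (B + 1) ≤ B := hB hcon
    have h2 : B + 1 ≤ m * (B + 1) := Nat.le_mul_of_pos_left _ (Nat.pos_of_ne_zero hm)
    omega
  classical
  refine ⟨Nat.find hex, ⟨(Nat.find_spec hex).1, fun z hz hcon => ?_⟩, (Nat.find_spec hex).2⟩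
  refine Nat.find_min hex (m := z) (by omega) ⟨hz, ?_⟩
  rw [← (Nat.find_spec hex).2, hcon]
  simp

theorem IsApery.eq_zero_or_gen {n : ℕ} [NeZero n] {a : Fin n → ℕ} {y : ℕ}
    (hy : IsApery (genSemigroup a) (a 0) y) :
    y = 0 ∨ (∃ i ≠ 0, y = a i) ∨ ∃ i ≠ 0, ∃ j ≠ 0, ∃ z ∈ genSemigroup a, y = a i + a j + z := by
  have hne : ∀ {i : Fin n} {z : ℕ}, z ∈ genSemigroup a →
      IsApery (genSemigroup a) (a 0) (a i + z) → i ≠ 0 := by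
    rintro i z hz h rfl
    exact h.2 z hz rfl
  rcases eq_zero_or_exists_eq_gen_add hy.1 with rfl | ⟨i, z, hz, rfl⟩
  · exact Or.inl rfl
  have hi := hne hz hy
  rcases eq_zero_or_exists_eq_gen_add hz with rfl | ⟨j, z, hz', rfl⟩
  · exact Or.inr (Or.inl ⟨i, hi, rfl⟩)
  · rw [add_comm] at hy
    have hj := hne hz' (hy.of_add hz (gen_mem a i))
    exact Or.inr (Or.inr ⟨i, hi, j, hj, z, hz', (add_assoc _ _ _).symm⟩)

/-- The Apéry set of a numerical semigroup of embedding dimension `n` and type at least `n - 1`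
whose decomposable Apéry elements all lie in a single principal ideal. -/
theorem apery_structure {n : ℕ} [NeZero n] (hn : 3 ≤ n) {a : Fin n → ℕ}
    (hinj : Function.Injective a) (ha0 : ∀ i, a i ≠ 0)
    (hirr : ∀ i, ∀ u ∈ genSemigroup a, ∀ v ∈ genSemigroup a, u ≠ 0 → v ≠ 0 → a i ≠ u + v)
    (hdec : ∃ i ≠ 0, ∃ j ≠ 0, ∀ u v, u ≠ 0 → v ≠ 0 →
      (∃ y ∈ genSemigroup a, a u + a v = a 0 + y) ∨
      ∃ y ∈ genSemigroup a, a u + a v = a i + a j + y)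
    {T : Finset ℕ} (hT : T.card = n - 1) (hTA : ∀ y ∈ T, IsApery (genSemigroup a) (a 0) y)
    (hTmax : ∀ y ∈ T, ∀ x ∈ genSemigroup a, x ≠ 0 → ¬ IsApery (genSemigroup a) (a 0) (y + x))
    {z : ℕ} (hz : z ∈ T) :
    ∃ q ≠ 0, ∃ s, 1 ≤ s ∧ (s = 1 → z = a q) ∧
      (∀ j, IsApery (genSemigroup a) (a 0) (j * a q) ↔ j ≤ s) ∧
      (∀ y, IsApery (genSemigroup a) (a 0) y →
        (∃ j ≤ s, y = j * a q) ∨ ∃ i, i ≠ 0 ∧ i ≠ q ∧ y = a i) ∧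
      ∀ y, y ∈ T ↔ y = s * a q ∨ ∃ i, i ≠ 0 ∧ i ≠ q ∧ y = a i := by
  classical
  set H := genSemigroup a with hHdef
  have hmem : ∀ i, a i ∈ H := gen_mem a
  have hmulmem : ∀ j i, j * a i ∈ H := fun j i => by
    simpa using nsmul_mem (hmem i) j
  have hgenA : ∀ i, i ≠ 0 → IsApery H (a 0) (a i) := by
    intro i hi
    refine ⟨hmem i, fun y hy heq => ?_⟩
    by_cases hy0 : y = 0
    · rw [hy0, add_zero] at heq
      exact hi (hinj heq)
    · exact hirr i _ (hmem 0) _ hy (ha0 0) hy0 heq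
  have hT0 : (0 : ℕ) ∉ T := by
    intro h0
    have hone : (⟨1, by omega⟩ : Fin n) ≠ 0 := by
      intro h; simpa using congrArg Fin.val h
    exact hTmax 0 h0 _ (hmem ⟨1, by omega⟩) (ha0 _) (by simpa using hgenA _ hone)
  by_cases hD : ∀ u v, u ≠ 0 → v ≠ 0 → ¬ IsApery H (a 0) (a u + a v)
  · have hcl : ∀ y, IsApery H (a 0) y → y = 0 ∨ ∃ i ≠ 0, y = a i := by
      intro y hy
      rcases hy.eq_zero_or_gen with h | h | ⟨i, hi, j, hj, w, hw, rfl⟩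
      · exact Or.inl h
      · exact Or.inr h
      · exact absurd (hy.of_add (add_mem (hmem i) (hmem j)) hw) (hD i j hi hj)
    have hTsub : T ⊆ (Finset.univ.erase 0).image a := by
      intro y hy
      rcases hcl y (hTA y hy) with rfl | ⟨i, hi, rfl⟩
      · exact absurd hy hT0
      · exact Finset.mem_image_of_mem a (Finset.mem_erase.2 ⟨hi, Finset.mem_univ _⟩)
    have hTeq := Finset.eq_of_subset_of_card_le hTsub (by
      rw [Finset.card_image_of_injective _ hinj, hT, Finset.card_erase_of_mem (Finset.mem_univ _),
        Finset.card_univ, Fintype.card_fin])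
    have hTmem : ∀ y, y ∈ T ↔ ∃ i ≠ 0, y = a i := by
      intro y
      rw [hTeq]
      simp [eq_comm]
    -- With no decomposable Apéry element, any nonzero index can serve as `q`; the one prescribed by
    -- `z` is taken.
    obtain ⟨q, hq, rfl⟩ := (hTmem z).1 hz
    refine ⟨q, hq, 1, le_rfl, fun _ => rfl, fun j => ⟨fun h => ?_, fun h => ?_⟩, fun y hy => ?_,
      fun y => ?_⟩
    · by_contra hcon
      obtain ⟨j, rfl⟩ : ∃ j', j = j' + 2 := ⟨j - 2, by omega⟩
      rw [show (j + 2) * a q = a q + a q + j * a q by ring] at h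
      exact hD q q hq hq (h.of_add (add_mem (hmem q) (hmem q)) (hmulmem j q))
    · interval_cases j
      · rw [zero_mul]
        exact IsApery.of_add (z := a q) (by simpa using hgenA q hq) (zero_mem _) (hmem q)
      · simpa using hgenA q hq
    · rcases hcl y hy with rfl | ⟨i, hi, rfl⟩
      · exact Or.inl ⟨0, by omega, by simp⟩
      · by_cases hiq : i = q
        · exact Or.inl ⟨1, le_rfl, by simp [hiq]⟩
        · exact Or.inr ⟨i, hi, hiq, rfl⟩
    · rw [hTmem, one_mul]
      constructor
      · rintro ⟨i, hi, rfl⟩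
        by_cases hiq : i = q
        · exact Or.inl (by rw [hiq])
        · exact Or.inr ⟨i, hi, hiq, rfl⟩
      · rintro (rfl | ⟨i, hi, -, rfl⟩)
        · exact ⟨q, hq, rfl⟩
        · exact ⟨i, hi, rfl⟩
  push Not at hD
  obtain ⟨u, v, hu, hv, huv⟩ := hD
  obtain ⟨i, hi, j, hj, hij⟩ := hdec
  have hAdd : ∀ u v y, u ≠ 0 → v ≠ 0 → y ∈ H → IsApery H (a 0) (a u + a v + y) →
      ∃ y' ∈ H, a u + a v + y = a i + a j + y' := by
    intro u v y hu hv hy h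
    rcases hij u v hu hv with ⟨w, hw, heq⟩ | ⟨w, hw, heq⟩
    · exact absurd heq ((h.of_add (add_mem (hmem u) (hmem v)) hy).2 w hw)
    · exact ⟨w + y, add_mem hw hy, by rw [heq, add_assoc]⟩
  have hw : IsApery H (a 0) (a i + a j) := by
    obtain ⟨y, hy, heq⟩ := hAdd u v 0 hu hv (zero_mem _) huv
    rw [add_zero] at heq
    exact (heq ▸ huv).of_add (add_mem (hmem i) (hmem j)) hy
  -- an Apéry element exceeding `a i + a j` by `y ≠ 0` exceeds it by a multiple of `a i` and `a j`
  have hstep : ∀ y ∈ H, y ≠ 0 → IsApery H (a 0) (a i + a j + y) →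
      (∃ y' ∈ H, y = a i + y') ∧ ∃ y' ∈ H, y = a j + y' := by
    intro y hy hy0 h
    obtain h0 | ⟨l, y, hy', rfl⟩ := eq_zero_or_exists_eq_gen_add hy
    · exact absurd h0 hy0
    have hl : l ≠ 0 := by
      rintro rfl
      exact h.2 (a i + a j + y) (add_mem (add_mem (hmem i) (hmem j)) hy') (by ring)
    constructor
    · rw [show a i + a j + (a l + y) = a j + a l + y + a i by ring] at h
      obtain ⟨y', hy'', heq⟩ := hAdd j l y hj hl hy'
        (h.of_add (add_mem (add_mem (hmem j) (hmem l)) hy') (hmem i))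
      exact ⟨y', hy'', by omega⟩
    · rw [show a i + a j + (a l + y) = a i + a l + y + a j by ring] at h
      obtain ⟨y', hy'', heq⟩ := hAdd i l y hi hl hy'
        (h.of_add (add_mem (add_mem (hmem i) (hmem l)) hy') (hmem j))
      exact ⟨y', hy'', by omega⟩
  have hcl : ∀ y, IsApery H (a 0) y → y = 0 ∨ (∃ l ≠ 0, y = a l) ∨
      ∃ y' ∈ H, y = a i + a j + y' := by
    intro y hy
    rcases hy.eq_zero_or_gen with h | h | ⟨u, hu, v, hv, y', hy', rfl⟩
    · exact Or.inl h
    · exact Or.inr (Or.inl h)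
    · exact Or.inr (Or.inr (hAdd u v y' hu hv hy' hy))
  have hiT : a i ∉ T := fun h => hTmax _ h _ (hmem j) (ha0 j) hw
  have hjT : a j ∉ T := fun h => hTmax _ h _ (hmem i) (ha0 i) (by rwa [add_comm])
  obtain rfl : i = j := by
    by_contra hne
    -- For `i ≠ j` nothing in the Apéry set exceeds `a i + a j`: otherwise `a i + a j + a i` is
    -- Apéry, and `hstep` puts `a i` in `a j + H`, against minimality. Then `T` has at most `n - 2`
    -- elements, since it misses `a i` and `a j`.
    have hD1 : ∀ y' ∈ H, IsApery H (a 0) (a i + a j + y') → y' = 0 := by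
      intro y' hy' h
      by_contra h0
      obtain ⟨⟨y'', hy'', rfl⟩, -⟩ := hstep y' hy' h0 h
      rw [← add_assoc] at h
      have h2 := h.of_add (add_mem (add_mem (hmem i) (hmem j)) (hmem i)) hy''
      obtain ⟨-, x, hx, heq⟩ := hstep _ (hmem i) (ha0 i) h2
      by_cases hx0 : x = 0
      · rw [hx0, add_zero] at heq
        exact hne (hinj heq)
      · exact hirr i _ (hmem j) _ hx (ha0 j) hx0 heq
    have hTsub : T ⊆ insert (a i + a j) ((((Finset.univ.erase 0).erase i).erase j).image a) := by
      intro y hy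
      rw [Finset.mem_insert]
      rcases hcl y (hTA y hy) with rfl | ⟨l, hl, rfl⟩ | ⟨y', hy', rfl⟩
      · exact absurd hy hT0
      · right
        refine Finset.mem_image_of_mem a ?_
        simp only [Finset.mem_erase, Finset.mem_univ, and_true]
        exact ⟨fun h => hjT (h ▸ hy), fun h => hiT (h ▸ hy), hl⟩
      · left
        rw [hD1 y' hy' (hTA _ hy), add_zero]
    have h1 := Finset.card_le_card hTsub
    have h2 := Finset.card_insert_le (a i + a j)
      ((((Finset.univ.erase 0).erase i).erase j).image a)
    rw [Finset.card_image_of_injective _ hinj, Finset.card_erase_of_mem, Finset.card_erase_of_mem,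
      Finset.card_erase_of_mem (Finset.mem_univ _), Finset.card_univ, Fintype.card_fin] at h2
    · omega
    · simpa using hi
    · simpa using ⟨Ne.symm hne, hj⟩
  have hmul : ∀ y, y ∈ H → IsApery H (a 0) (a i + a i + y) → ∃ l, y = l * a i := by
    intro y
    induction y using Nat.strong_induction_on with
    | _ y ih =>
      intro hy h
      by_cases hy0 : y = 0
      · exact ⟨0, by simp [hy0]⟩
      obtain ⟨⟨y', hy', rfl⟩, -⟩ := hstep y hy hy0 h
      have hpos := ha0 i
      rw [add_comm (a i) y', ← add_assoc] at h
      obtain ⟨l, hl⟩ := ih y' (by omega) hy'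
        (h.of_add (add_mem (add_mem (hmem i) (hmem i)) hy') (hmem i))
      exact ⟨l + 1, by rw [hl]; ring⟩
  have hex : ∃ l, ¬ IsApery H (a 0) (l * a i) := by
    -- `a 0 * a i` is also a positive multiple of `a 0`, hence not Apéry.
    refine ⟨a 0, fun h => ?_⟩
    obtain ⟨c, hc⟩ := Nat.exists_eq_succ_of_ne_zero (ha0 i)
    refine h.2 (c * a 0) (hmulmem c 0) ?_
    rw [hc, Nat.succ_eq_add_one]; ring
  have hdown : ∀ {l l'}, l ≤ l' → IsApery H (a 0) (l' * a i) → IsApery H (a 0) (l * a i) := by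
    intro l l' hle h
    obtain ⟨d, rfl⟩ := Nat.exists_eq_add_of_le hle
    rw [add_mul] at h
    exact h.of_add (hmulmem l i) (hmulmem d i)
  have h2A : IsApery H (a 0) (2 * a i) := by rwa [two_mul]
  have hfind : 2 < Nat.find hex := by
    by_contra hcon
    exact Nat.find_spec hex (hdown (not_lt.1 hcon) h2A)
  obtain ⟨s, hs⟩ : ∃ s, Nat.find hex = s + 1 := ⟨Nat.find hex - 1, by omega⟩
  have hsA : ∀ l, IsApery H (a 0) (l * a i) ↔ l ≤ s := by
    intro l
    constructor
    · intro h
      by_contra hcon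
      exact Nat.find_spec hex (hdown (by omega) h)
    · intro h
      by_contra hcon
      have := Nat.find_min' hex hcon
      omega
  have hcl' : ∀ y, IsApery H (a 0) y →
      (∃ l ≤ s, y = l * a i) ∨ ∃ l, l ≠ 0 ∧ l ≠ i ∧ y = a l := by
    intro y hy
    rcases hcl y hy with rfl | ⟨l, hl, rfl⟩ | ⟨y', hy', rfl⟩
    · exact Or.inl ⟨0, by omega, by simp⟩
    · by_cases hli : l = i
      · exact Or.inl ⟨1, by omega, by simp [hli]⟩
      · exact Or.inr ⟨l, hl, hli, rfl⟩
    · obtain ⟨l, rfl⟩ := hmul y' hy' hy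
      have heq : a i + a i + l * a i = (l + 2) * a i := by ring
      exact Or.inl ⟨l + 2, (hsA _).1 (heq ▸ hy), heq⟩
  have hTsub : T ⊆ insert (s * a i) (((Finset.univ.erase 0).erase i).image a) := by
    intro y hy
    rw [Finset.mem_insert]
    rcases hcl' y (hTA y hy) with ⟨l, hl, rfl⟩ | ⟨l, hl, hli, rfl⟩
    · left
      rcases hl.eq_or_lt with rfl | hlt
      · rfl
      · refine absurd ((hsA (l + 1)).2 hlt) ?_
        rw [add_one_mul]
        exact hTmax _ hy _ (hmem i) (ha0 i)
    · exact Or.inr (Finset.mem_image_of_mem a (by simpa using ⟨hli, hl⟩))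
  -- The larger set has at most `1 + (n - 2)` elements, exactly the size of `T`.
  have hTeq := Finset.eq_of_subset_of_card_le hTsub (by
    refine (Finset.card_insert_le _ _).trans ?_
    rw [Finset.card_image_of_injective _ hinj, hT, Finset.card_erase_of_mem (by simpa using hi),
      Finset.card_erase_of_mem (Finset.mem_univ _), Finset.card_univ, Fintype.card_fin]
    omega)
  refine ⟨i, hi, s, by omega, fun h => by omega, hsA, hcl', fun y => ?_⟩
  rw [hTeq, Finset.mem_insert, Finset.mem_image]
  simp only [Finset.mem_erase, Finset.mem_univ, and_true]
  constructor
  · rintro (h | ⟨l, ⟨h1, h2⟩, h3⟩)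
    · exact Or.inl h
    · exact Or.inr ⟨l, h2, h1, h3.symm⟩
  · rintro (h | ⟨l, h1, h2, h3⟩)
    · exact Or.inl h
    · exact Or.inr ⟨l, ⟨h2, h1⟩, h3.symm⟩

/-! ### Pseudo-Frobenius numbers as maximal Apéry elements -/

theorem natCast_mem_intSemigroup {H : AddSubmonoid ℕ} {y : ℕ} :
    (y : ℤ) ∈ intSemigroup H ↔ y ∈ H := by
  simp [intSemigroup]

theorem isApery_of_mem_pseudoFrobenius {H : AddSubmonoid ℕ} {m y : ℕ} (hm : m ∈ H) (hm0 : m ≠ 0)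
    {z : ℤ} (hz : z ∈ pseudoFrobenius H) (hy : (y : ℤ) = z + m) :
    IsApery H m y ∧ ∀ x ∈ H, x ≠ 0 → ¬ IsApery H m (y + x) := by
  refine ⟨⟨?_, ?_⟩, ?_⟩
  · rw [← natCast_mem_intSemigroup, hy]
    exact hz.2 m (natCast_mem_intSemigroup.2 hm) (by exact_mod_cast Nat.pos_of_ne_zero hm0)
  · intro w hw heq
    apply hz.1
    have : z = (w : ℤ) := by omega
    rw [this]
    exact natCast_mem_intSemigroup.2 hw
  · intro x hx hx0 h
    obtain ⟨w, hw, hwz⟩ := hz.2 x (natCast_mem_intSemigroup.2 hx) (by omega)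
    have hwz' : (w : ℤ) = z + x := hwz
    exact h.2 w hw (by omega)

/-! ### Normal forms modulo the minors -/

/-- `f` is a power of `y 0` times one of `1, y 1, …, (y 1) ^ ℓ, y 2, …, y (n - 1)`. -/
def IsStandardMonomial {R : Type*} [CommRing R] (n ℓ : ℕ) (y : ℕ → R) (f : R) : Prop :=
  ∃ t : ℕ, (∃ j ≤ ℓ, f = y 0 ^ t * y 1 ^ j) ∨ ∃ i, 2 ≤ i ∧ i < n ∧ f = y 0 ^ t * y i

namespace IsStandardMonomial

variable {R : Type*} [CommRing R] {n ℓ : ℕ} {y : ℕ → R} {f : R}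

theorem pow_mul (h : IsStandardMonomial n ℓ y f) (q : ℕ) :
    IsStandardMonomial n ℓ y (y 0 ^ q * f) := by
  obtain ⟨t, ⟨j, hj, rfl⟩ | ⟨i, hi, hin, rfl⟩⟩ := h
  · exact ⟨q + t, Or.inl ⟨j, hj, by ring⟩⟩
  · exact ⟨q + t, Or.inr ⟨i, hi, hin, by ring⟩⟩

/-- Each factor `y 1` raises the index of `y i` by one at the cost of `y 0 ^ e`, until the index
reaches `n`, where `y n` is a power of `y 0`. -/
theorem gen_mul_pow {e p : ℕ} (hy : y n = y 0 ^ p)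
    (h1 : ∀ i, 2 ≤ i → i < n → y i * y 1 = y 0 ^ e * y (i + 1)) {j : ℕ} (hj : j ≤ ℓ) {i : ℕ}
    (hi : 2 ≤ i) (hin : i ≤ n) : IsStandardMonomial n ℓ y (y i * y 1 ^ j) := by
  induction j generalizing i with
  | zero =>
    rcases hin.eq_or_lt with rfl | hlt
    · exact ⟨p, Or.inl ⟨0, hj, by rw [hy]⟩⟩
    · exact ⟨0, Or.inr ⟨i, hi, hlt, by ring⟩⟩
  | succ j ih =>
    rcases hin.eq_or_lt with rfl | hlt
    · exact ⟨p, Or.inl ⟨j + 1, hj, by rw [hy]⟩⟩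
    · have : y i * y 1 ^ (j + 1) = y 0 ^ e * (y (i + 1) * y 1 ^ j) := by
        rw [pow_succ', ← mul_assoc, h1 i hi hlt, mul_assoc]
      rw [this]
      exact (ih (by omega) (by omega) (by omega)).pow_mul e

/-- The relation `h3` moves the two indices apart, until the upper one reaches `n` or the lower one
reaches `2`, where `h2` applies. -/
theorem gen_mul_gen {e p : ℕ} (hy : y n = y 0 ^ p)
    (h1 : ∀ i, 2 ≤ i → i < n → y i * y 1 = y 0 ^ e * y (i + 1))
    (h2 : ∀ i, 2 ≤ i → i < n → y i * y 2 = y 1 ^ ℓ * y (i + 1))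
    (h3 : ∀ i j, 2 ≤ i → i < n → 2 ≤ j → j < i → y i * y (j + 1) = y j * y (i + 1))
    {j : ℕ} (hj : 2 ≤ j) {i : ℕ} (hji : j ≤ i) (hin : i < n) :
    IsStandardMonomial n ℓ y (y i * y j) := by
  induction j, hj using Nat.le_induction generalizing i with
  | base =>
    rw [h2 i hji hin, mul_comm]
    exact gen_mul_pow hy h1 le_rfl (by omega) (by omega)
  | succ j hj ih =>
    rw [h3 i j (by omega) hin hj (by omega)]
    rcases Nat.eq_or_lt_of_le (Nat.succ_le_of_lt hin) with h | h
    · rw [show i + 1 = n from h, hy, mul_comm]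
      exact ⟨p, Or.inr ⟨j, hj, by omega, rfl⟩⟩
    · rw [mul_comm]
      exact ih (by omega) h

/-- Closure under multiplication by each variable is what makes every monomial standard. -/
theorem gen_mul {e p : ℕ} (hn : 3 ≤ n) (hy : y n = y 0 ^ p)
    (h0 : y 1 ^ (ℓ + 1) = y 0 ^ e * y 2)
    (h1 : ∀ i, 2 ≤ i → i < n → y i * y 1 = y 0 ^ e * y (i + 1))
    (h2 : ∀ i, 2 ≤ i → i < n → y i * y 2 = y 1 ^ ℓ * y (i + 1))
    (h3 : ∀ i j, 2 ≤ i → i < n → 2 ≤ j → j < i → y i * y (j + 1) = y j * y (i + 1))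
    (hf : IsStandardMonomial n ℓ y f) {i : ℕ} (hi : i < n) :
    IsStandardMonomial n ℓ y (y i * f) := by
  rcases Nat.eq_zero_or_pos i with rfl | hi0
  · simpa using hf.pow_mul 1
  obtain ⟨t, ⟨j, hj, rfl⟩ | ⟨l, hl, hln, rfl⟩⟩ := hf
  · rw [mul_left_comm]
    refine pow_mul ?_ t
    rcases Nat.eq_or_lt_of_le (Nat.succ_le_of_lt hi0) with rfl | hi2
    · rw [Nat.succ_eq_add_one, zero_add, ← pow_succ']
      rcases hj.eq_or_lt with rfl | hlt
      · rw [h0]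
        exact ⟨e, Or.inr ⟨2, le_rfl, hn, rfl⟩⟩
      · exact ⟨0, Or.inl ⟨j + 1, hlt, by ring⟩⟩
    · exact gen_mul_pow hy h1 hj hi2 hi.le
  · rw [mul_left_comm]
    refine pow_mul ?_ t
    rcases Nat.eq_or_lt_of_le (Nat.succ_le_of_lt hi0) with rfl | hi2
    · rw [Nat.succ_eq_add_one, zero_add, mul_comm, h1 l hl hln]
      rcases Nat.eq_or_lt_of_le (Nat.succ_le_of_lt hln) with h | h
      · rw [show l + 1 = n from h, hy, ← pow_add]
        exact ⟨e + p, Or.inl ⟨0, Nat.zero_le _, by ring⟩⟩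
      · exact ⟨e, Or.inr ⟨l + 1, by omega, h, rfl⟩⟩
    · rcases le_total l i with hle | hle
      · exact gen_mul_gen hy h1 h2 h3 hl hle hi
      · rw [mul_comm]
        exact gen_mul_gen hy h1 h2 h3 hi2 hle hln

end IsStandardMonomial

/-! ### The defining ideal as an ideal of minors -/

theorem minor_mem_minorsIdeal {R : Type*} [CommRing R] {q : ℕ} (M : Matrix (Fin 2) (Fin q) R)
    (c d : Fin q) : M 0 c * M 1 d - M 0 d * M 1 c ∈ minorsIdeal 2 M := by
  have key : ∀ c d : Fin q, c < d → M 0 c * M 1 d - M 0 d * M 1 c ∈ minorsIdeal 2 M := by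
    intro c d hcd
    refine Ideal.subset_span ⟨RelEmbedding.refl _, OrderEmbedding.ofStrictMono ![c, d] ?_, ?_⟩
    · intro i j hij
      fin_cases i <;> fin_cases j <;> simp_all
    · rw [Matrix.det_fin_two]
      rfl
  rcases lt_trichotomy c d with h | rfl | h
  · exact key c d h
  · simp
  · rw [← neg_sub]
    exact neg_mem (key d c h)

theorem minorsIdeal_two_le_ker {R B : Type*} [CommRing R] [CommRing B] {q : ℕ}
    (M : Matrix (Fin 2) (Fin q) R) (φ : R →+* B)
    (h : ∀ c d, φ (M 0 c) * φ (M 1 d) = φ (M 0 d) * φ (M 1 c)) :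
    minorsIdeal 2 M ≤ RingHom.ker φ := by
  refine Ideal.span_le.2 ?_
  rintro _ ⟨r, c, rfl⟩
  have hr : r 0 < r 1 := r.strictMono (by decide)
  have hr0 : r 0 = 0 := by omega
  have hr1 : r 1 = 1 := by omega
  simp only [SetLike.mem_coe, RingHom.mem_ker, Matrix.det_fin_two, Matrix.submatrix_apply, hr0,
    hr1, map_sub, map_mul, h (c 0) (c 1), sub_self]

/-- The defining ideal of a monomial curve, as the kernel of a map to `k[X]`. -/
theorem mem_definingIdeal {k : Type*} [Field k] {n : ℕ} (b : Fin n → ℕ)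
    (f : MvPolynomial (Fin n) k) :
    f ∈ definingIdeal k b ↔ MvPolynomial.aeval (fun i => (X : k[X]) ^ b i) f = 0 := by
  have h : (semigroupRing k b).val.comp (semigroupRingMap k b) =
      MvPolynomial.aeval (fun i => (X : k[X]) ^ b i) := by
    ext i
    simp [semigroupRingMap, tPow]
  rw [← h, definingIdeal, RingHom.mem_ker, AlgHom.comp_apply]
  exact (map_eq_zero_iff (semigroupRing k b).val Subtype.val_injective).symm

/-- By `hdeg` the two entries of every column differ in degree by `β`, so the minors vanish on the
curve. The congruence hypotheses separate the standard monomials by degree; as these span the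
quotient by the minors, the quotient embeds in `k[X]`. -/
theorem definingIdeal_eq_minorsIdeal {k : Type*} [Field k] {n : ℕ} [NeZero n] (hn : 3 ≤ n)
    (b : Fin n → ℕ) (e ℓ p : ℕ) (β : ℤ) (hb0 : b 0 ≠ 0)
    (hdeg : ∀ c : Fin n,
      (((if c.val = 0 then e * b 0 else if c.val = 1 then ℓ * b c else b c : ℕ) : ℤ) + β =
        ((if hc : c.val + 1 < n then b ⟨c.val + 1, hc⟩ else p * b 0 : ℕ) : ℤ)))
    (hpow : ∀ i j, i ≤ ℓ → j ≤ ℓ → i * b ⟨1, by omega⟩ ≡ j * b ⟨1, by omega⟩ [MOD b 0] → i = j)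
    (hgen : ∀ i j : Fin n, 2 ≤ i.val → 2 ≤ j.val → b i ≡ b j [MOD b 0] → i = j)
    (hpg : ∀ i, i ≤ ℓ → ∀ j : Fin n, 2 ≤ j.val → ¬ i * b ⟨1, by omega⟩ ≡ b j [MOD b 0]) :
    definingIdeal k b = minorsIdeal 2 (curveMatrix k n e ℓ p) := by
  set ψ : MvPolynomial (Fin n) k →ₐ[k] k[X] :=
    MvPolynomial.aeval (fun i => (X : k[X]) ^ b i) with hψ
  set I := minorsIdeal 2 (curveMatrix k n e ℓ p) with hI
  have htop : ∀ c : Fin n, ψ (curveMatrix k n e ℓ p 0 c) =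
      X ^ (if c.val = 0 then e * b 0 else if c.val = 1 then ℓ * b c else b c) := by
    intro c
    simp only [curveMatrix, Matrix.of_apply, Matrix.cons_val_zero]
    split_ifs <;> simp [hψ, ← pow_mul, mul_comm]
  have hbot : ∀ c : Fin n, ψ (curveMatrix k n e ℓ p 1 c) =
      X ^ (if hc : c.val + 1 < n then b ⟨c.val + 1, hc⟩ else p * b 0) := by
    intro c
    simp only [curveMatrix, Matrix.of_apply, Matrix.cons_val_one]
    by_cases h : c.val + 1 < n <;> simp [hψ, h, ← pow_mul, mul_comm]
  have hle : I ≤ RingHom.ker ψ.toRingHom := by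
    refine minorsIdeal_two_le_ker _ _ fun c d => ?_
    change ψ _ * ψ _ = ψ _ * ψ _
    rw [htop, htop, hbot, hbot, ← pow_add, ← pow_add]
    congr 1
    have h1 := hdeg c
    have h2 := hdeg d
    omega
  apply le_antisymm
  swap
  · exact fun f hf => (mem_definingIdeal b f).2 (hle hf)
  set π : MvPolynomial (Fin n) k →ₐ[k] (MvPolynomial (Fin n) k ⧸ I) := Ideal.Quotient.mkₐ k I
    with hπ
  set ψ' : (MvPolynomial (Fin n) k ⧸ I) →+* k[X] := Ideal.Quotient.lift I ψ.toRingHom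
    (fun f hf => hle hf) with hψ'
  have hψπ : ∀ f, ψ' (π f) = ψ f := fun f => rfl
  -- Letting `y n` be the last entry `X_1 ^ p` makes the bottom row uniformly `y (i + 1)`.
  set y : ℕ → MvPolynomial (Fin n) k ⧸ I := fun i =>
    if hi : i < n then π (MvPolynomial.X ⟨i, hi⟩) else π (MvPolynomial.X 0) ^ p with hy
  have hylt : ∀ i (hi : i < n), y i = π (MvPolynomial.X ⟨i, hi⟩) := fun i hi => dif_pos hi
  have hyn : y n = y 0 ^ p := by
    rw [hylt 0 (by omega)]
    exact dif_neg (lt_irrefl n)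
  have hrel : ∀ c d : Fin n, π (curveMatrix k n e ℓ p 0 c) * π (curveMatrix k n e ℓ p 1 d) =
      π (curveMatrix k n e ℓ p 0 d) * π (curveMatrix k n e ℓ p 1 c) := by
    intro c d
    rw [← map_mul, ← map_mul]
    exact Ideal.Quotient.eq.2 (minor_mem_minorsIdeal _ c d)
  have hbotπ : ∀ i (hi : i < n), π (curveMatrix k n e ℓ p 1 ⟨i, hi⟩) = y (i + 1) := by
    intro i hi
    simp only [curveMatrix, Matrix.of_apply, Matrix.cons_val_one, hy]
    by_cases h : i + 1 < n <;> simp [h]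
  have htop0 : π (curveMatrix k n e ℓ p 0 ⟨0, by omega⟩) = y 0 ^ e := by
    rw [hylt 0 (by omega)]
    simp [curveMatrix]
  have htop1 : π (curveMatrix k n e ℓ p 0 ⟨1, by omega⟩) = y 1 ^ ℓ := by
    rw [hylt 1 (by omega)]
    simp [curveMatrix]
  have htop2 : ∀ i (hi : i < n), 2 ≤ i → π (curveMatrix k n e ℓ p 0 ⟨i, hi⟩) = y i := by
    intro i hi h2
    rw [hylt i hi]
    simp [curveMatrix, show i ≠ 0 by omega, show i ≠ 1 by omega]
  have hstd : ∀ u : Fin n →₀ ℕ, IsStandardMonomial n ℓ y (π (MvPolynomial.monomial u 1)) := by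
    intro u
    have hmem : (MvPolynomial.monomial u (1 : k)) ∈
        Submonoid.closure (Set.range (MvPolynomial.X : Fin n → MvPolynomial (Fin n) k)) := by
      rw [MvPolynomial.monomial_eq, map_one, one_mul]
      exact prod_mem fun i _ => pow_mem (Submonoid.subset_closure (Set.mem_range_self i)) _
    generalize MvPolynomial.monomial u (1 : k) = g at hmem
    induction hmem using Submonoid.closure_induction_left with
    | one => exact ⟨0, Or.inl ⟨0, Nat.zero_le _, by simp⟩⟩
    | mul_left g hg f _ hf =>
      obtain ⟨i, rfl⟩ := hg
      rw [map_mul, ← hylt i.1 i.2]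
      refine IsStandardMonomial.gen_mul (e := e) hn hyn ?_ ?_ ?_ ?_ hf i.2
      · have := hrel ⟨1, by omega⟩ ⟨0, by omega⟩
        rw [htop0, htop1, hbotπ, hbotπ] at this
        rw [pow_succ]; exact this
      · intro i hi hin
        have := hrel ⟨i, hin⟩ ⟨0, by omega⟩
        rwa [htop0, htop2 i hin hi, hbotπ, hbotπ] at this
      · intro i hi hin
        have := hrel ⟨i, hin⟩ ⟨1, by omega⟩
        rwa [htop1, htop2 i hin hi, hbotπ, hbotπ] at this
      · intro i j hi hin hj hji
        have := hrel ⟨i, hin⟩ ⟨j, by omega⟩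
        rwa [htop2 j _ hj, htop2 i hin hi, hbotπ, hbotπ] at this
  have hyψ : ∀ i (hi : i < n), ψ' (y i) = X ^ b ⟨i, hi⟩ := by
    intro i hi
    rw [hylt i hi, hψπ, hψ, MvPolynomial.aeval_X]
  have hy0ψ : ψ' (y 0) = X ^ b 0 := hyψ 0 (by omega)
  have huniq : ∀ f g, IsStandardMonomial n ℓ y f → IsStandardMonomial n ℓ y g →
      ψ' f = ψ' g → f = g := by
    have hX : ∀ {q r : ℕ}, (X : k[X]) ^ q = X ^ r → q = r := fun {q r} h => by
      simpa using congrArg natDegree h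
    have hcancel : ∀ {t t' d d' : ℕ}, t * b 0 + d = t' * b 0 + d' → d ≡ d' [MOD b 0] := by
      intro t t' d d' h
      have h' := congrArg (· % b 0) h
      simpa [Nat.ModEq, Nat.add_mod] using h'
    have hcancel' : ∀ {t t' d : ℕ}, t * b 0 + d = t' * b 0 + d → t = t' := by
      intro t t' d h
      exact Nat.eq_of_mul_eq_mul_right (Nat.pos_of_ne_zero hb0) (Nat.add_right_cancel h)
    rintro f g ⟨t, ⟨j, hj, rfl⟩ | ⟨i, hi, hin, rfl⟩⟩ ⟨t', ⟨j', hj', rfl⟩ | ⟨i', hi', hin', rfl⟩⟩ h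
    · simp only [map_mul, map_pow, hy0ψ, hyψ 1 (by omega), ← pow_mul, ← pow_add] at h
      have h' := hX h
      rw [mul_comm (b 0), mul_comm (b 0), mul_comm _ j, mul_comm _ j'] at h'
      obtain rfl := hpow j j' hj hj' (hcancel h')
      rw [hcancel' h']
    · simp only [map_mul, map_pow, hy0ψ, hyψ 1 (by omega), hyψ i' hin', ← pow_mul,
        ← pow_add] at h
      have h' := hX h
      rw [mul_comm (b 0), mul_comm (b 0), mul_comm _ j] at h'
      exact absurd (hcancel h') (hpg j hj ⟨i', hin'⟩ hi')
    · simp only [map_mul, map_pow, hy0ψ, hyψ 1 (by omega), hyψ i hin, ← pow_mul,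
        ← pow_add] at h
      have h' := hX h
      rw [mul_comm (b 0), mul_comm (b 0), mul_comm _ j'] at h'
      exact absurd (hcancel h').symm (hpg j' hj' ⟨i, hin⟩ hi)
    · simp only [map_mul, map_pow, hy0ψ, hyψ i' hin', hyψ i hin, ← pow_mul, ← pow_add] at h
      have h' := hX h
      rw [mul_comm (b 0), mul_comm (b 0)] at h'
      have hii := hgen ⟨i, hin⟩ ⟨i', hin'⟩ hi hi' (hcancel h')
      obtain rfl : i = i' := congrArg Fin.val hii
      rw [hcancel' h']
  -- the quotient map factors linearly through `ψ`
  set d : (Fin n →₀ ℕ) → ℕ := fun u => u.sum fun i q => q * b i with hd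
  have hψmon : ∀ u, ψ (MvPolynomial.monomial u 1) = X ^ d u := by
    intro u
    change _ = X ^ ∑ i ∈ u.support, u i * b i
    rw [hψ, MvPolynomial.aeval_monomial, map_one, one_mul, Finsupp.prod,
      ← Finset.prod_pow_eq_pow_sum]
    exact Finset.prod_congr rfl fun i _ => by rw [← pow_mul, mul_comm]
  classical
  -- The class of any monomial of degree `q`; by `huniq` the choice is immaterial.
  let N : ℕ → MvPolynomial (Fin n) k ⧸ I := fun q =>
    if h : ∃ u, d u = q then π (MvPolynomial.monomial h.choose 1) else 0
  have hN : ∀ u, N (d u) = π (MvPolynomial.monomial u 1) := by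
    intro u
    have h : ∃ v, d v = d u := ⟨u, rfl⟩
    have h1 : N (d u) = π (MvPolynomial.monomial h.choose 1) := dif_pos h
    rw [h1]
    refine huniq _ _ (hstd _) (hstd _) ?_
    rw [hψπ, hψπ, hψmon, hψmon, h.choose_spec]
  let L : k[X] →ₗ[k] (MvPolynomial (Fin n) k ⧸ I) := (Polynomial.basisMonomials k).constr k N
  have hL : ∀ q, L (X ^ q) = N q := by
    intro q
    rw [← Polynomial.monomial_one_right_eq_X_pow, ← (Polynomial.basisMonomials k).constr_basis k N q,
      Polynomial.coe_basisMonomials]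
  have hcomp : L ∘ₗ ψ.toLinearMap = π.toLinearMap := by
    refine (MvPolynomial.basisMonomials (Fin n) k).ext fun u => ?_
    simp only [MvPolynomial.coe_basisMonomials, LinearMap.comp_apply, AlgHom.toLinearMap_apply]
    rw [hψmon, hL, hN]
  intro f hf
  have h1 := LinearMap.congr_fun hcomp f
  have h2 : ψ f = 0 := (mem_definingIdeal b f).1 hf
  simp only [LinearMap.comp_apply, AlgHom.toLinearMap_apply, h2, map_zero] at h1
  exact Ideal.Quotient.eq_zero_iff_mem.1 h1.symm

/-! ### Ordering the generators and reading off the exponents -/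

theorem theorem3p1 {k : Type*} [Field k] (n : ℕ) [NeZero n] (hn : 3 ≤ n) (a : Fin n → ℕ)
    (hH : IsNumericalSemigroup (genSemigroup a))
    (hdim : embDim (genSemigroup a) = n)
    (hmult : IsMultiplicity (genSemigroup a) (a 0))
    (ha : 3 ≤ a 0)
    (hstr : IsStretched (semigroupRing k a ⧸ Ideal.span {tPow k a 0}))
    (hPF : ∃ h α : ℤ, 0 ≤ h ∧ 0 < α ∧
      pseudoFrobenius (genSemigroup a) =
        {z : ℤ | ∃ i : ℕ, 1 ≤ i ∧ i ≤ n - 1 ∧ z = h + (i : ℤ) * α}) :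
    ∃ σ : Equiv.Perm (Fin n), σ 0 = 0 ∧
      ∃ e ℓ p : ℕ, 0 < e ∧ 0 < ℓ ∧ 0 < p ∧
        definingIdeal k (a ∘ σ) = minorsIdeal 2 (curveMatrix k n e ℓ p) := by
  obtain ⟨h, α, hh, hα, hPF⟩ := hPF
  lift h to ℕ using hh
  lift α to ℕ using hα.le
  have hα : 0 < α := by exact_mod_cast hα
  have hinj := injective_of_embDim_eq hdim
  have ha0 := gen_ne_zero_of_embDim_eq hdim
  set H := genSemigroup a with hHdef
  have hmem : ∀ i, a i ∈ H := gen_mem a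
  have hirr : ∀ i, ∀ u ∈ H, ∀ v ∈ H, u ≠ 0 → v ≠ 0 → a i ≠ u + v :=
    fun i u hu v hv => gen_ne_add_of_embDim_eq hdim i hu hv
  set x : ℕ → ℕ := fun i => h + a 0 + i * α with hx
  have hxinj : ∀ {i j}, x i = x j → i = j := fun {i j} hij =>
    Nat.eq_of_mul_eq_mul_right hα (Nat.add_left_cancel hij)
  have hxsucc : ∀ i, x (i + 1) = x i + α := fun i => by simp only [hx]; ring
  have hxPF : ∀ i, 1 ≤ i → i ≤ n - 1 → IsApery H (a 0) (x i) ∧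
      ∀ y ∈ H, y ≠ 0 → ¬ IsApery H (a 0) (x i + y) := by
    intro i hi1 hin
    have hz : (h : ℤ) + i * α ∈ pseudoFrobenius H := by
      rw [hPF]; exact ⟨i, hi1, hin, rfl⟩
    exact isApery_of_mem_pseudoFrobenius (hmem 0) (ha0 0) hz (by simp only [hx]; push_cast; ring)
  obtain ⟨q, hq, s, hs1, hsz, hsA, hcl, hT⟩ := apery_structure (T := (Finset.Icc 1 (n - 1)).image x)
    -- When `s = 1` the choice of `q` is free; taking `a q = x 1` gives `c = 1`, as the partition
    -- lemma then requires.
    (z := x 1) hn hinj ha0 hirr (hstr.exists_add_mem (by omega) ha0)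
    (by rw [Finset.card_image_of_injective _ fun _ _ => hxinj]; simp)
    (by
      intro y hy
      obtain ⟨i, hi, rfl⟩ := Finset.mem_image.1 hy
      exact (hxPF i (Finset.mem_Icc.1 hi).1 (Finset.mem_Icc.1 hi).2).1)
    (by
      intro y hy
      obtain ⟨i, hi, rfl⟩ := Finset.mem_image.1 hy
      exact (hxPF i (Finset.mem_Icc.1 hi).1 (Finset.mem_Icc.1 hi).2).2)
    (Finset.mem_image_of_mem x (Finset.mem_Icc.2 ⟨le_rfl, by omega⟩))
  rw [← hHdef] at hsA hcl
  have hqpos : 0 < a q := Nat.pos_of_ne_zero (ha0 q)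
  have hmulinj : ∀ {i j}, i * a q = j * a q → i = j := fun {i j} hij =>
    Nat.eq_of_mul_eq_mul_right hqpos hij
  have hTx : ∀ y, (y = s * a q ∨ ∃ i, i ≠ 0 ∧ i ≠ q ∧ y = a i) →
      ∃ i, 1 ≤ i ∧ i ≤ n - 1 ∧ x i = y := by
    intro y hy
    obtain ⟨i, hi, hxy⟩ := Finset.mem_image.1 ((hT y).2 hy)
    exact ⟨i, (Finset.mem_Icc.1 hi).1, (Finset.mem_Icc.1 hi).2, hxy⟩
  obtain ⟨c, hc1, hcn, hxc⟩ := hTx _ (Or.inl rfl)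
  have hxgen : ∀ i, 1 ≤ i → i ≤ n - 1 → i ≠ c → ∃ l, l ≠ 0 ∧ l ≠ q ∧ x i = a l := by
    intro i hi1 hin hic
    rcases (hT (x i)).1 (Finset.mem_image_of_mem x (Finset.mem_Icc.2 ⟨hi1, hin⟩)) with h1 | h1
    · exact absurd (hxinj (h1.trans hxc.symm)) hic
    · exact h1
  have hmulgen : ∀ j l, l ≠ q → j * a q ≠ a l := by
    intro j l hlq heq
    rcases Nat.lt_or_ge j 2 with hj | hj
    · interval_cases j
      · exact ha0 l (by omega)
      · exact hlq (hinj (by omega))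
    · obtain ⟨j, rfl⟩ : ∃ j', j = j' + 2 := ⟨j - 2, by omega⟩
      refine hirr l (a q) (hmem q) ((j + 1) * a q)
        (by simpa using nsmul_mem (hmem q) (j + 1)) (ha0 q) (by positivity) ?_
      rw [← heq]; ring
  have hcast : ∀ {y z : ℕ}, IsApery H (a 0) y → IsApery H (a 0) z →
      (y : ZMod (a 0)) = z → y = z := fun hy hz => hy.eq_of_natCast_eq (hmem 0) hz
  have hxcast : ∀ i, ((x i : ℕ) : ZMod (a 0)) = ((h + a 0 : ℕ) : ZMod (a 0)) + i • (α : ZMod (a 0)) :=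
    fun i => by simp [hx]
  have hpart := eq_or_eq_neg_of_partition (G := ZMod (a 0)) (a := (a q : ZMod (a 0)))
    (x := ((h + a 0 : ℕ) : ZMod (a 0))) (α := (α : ZMod (a 0))) (s := s) (N := n - 1) (c := c)
    (by omega)
    (by
      rcases hs1.eq_or_lt with h1 | h1
      · have h2 := hsz h1.symm
        rw [← h1, one_mul, ← h2] at hxc
        exact Or.inr ⟨h1.symm, hxinj hxc⟩
      · exact Or.inl h1)
    (by
      intro g
      obtain ⟨y, hy, rfl⟩ := exists_isApery_natCast_eq hH (ha0 0) g
      have key : (y = s * a q ∨ ∃ i, i ≠ 0 ∧ i ≠ q ∧ y = a i) → ∃ i, 1 ≤ i ∧ i ≤ n - 1 ∧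
          (y : ZMod (a 0)) = ((h + a 0 : ℕ) : ZMod (a 0)) + i • (α : ZMod (a 0)) := by
        intro hy'
        obtain ⟨i, hi1, hin, rfl⟩ := hTx y hy'
        exact ⟨i, hi1, hin, hxcast i⟩
      rcases hcl y hy with ⟨j, hj, rfl⟩ | hgen
      · rcases hj.eq_or_lt with rfl | hlt
        · exact Or.inr (key (Or.inl rfl))
        · exact Or.inl ⟨j, hlt, by simp⟩
      · exact Or.inr (key (Or.inr hgen)))
    (by
      intro j hj i hi1 hin heq
      rw [← hxcast, nsmul_eq_mul, ← Nat.cast_mul] at heq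
      have heq' := hcast ((hsA j).2 hj.le) (hxPF i hi1 hin).1 heq
      by_cases hic : i = c
      · rw [hic, hxc] at heq'
        exact hj.ne (hmulinj heq')
      · obtain ⟨l, -, hlq, hl⟩ := hxgen i hi1 hin hic
        exact hmulgen j l hlq (heq'.trans hl))
    (by
      intro i j hi1 hin hj1 hjn heq
      rw [← hxcast, ← hxcast] at heq
      exact hxinj (hcast (hxPF i hi1 hin).1 (hxPF j hj1 hjn).1 heq))
    hc1 hcn (by rw [← hxcast, hxc]; simp)
  -- Here `π` is the order in which the progression fills positions `2, …, n - 1`, and `β` is the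
  -- common degree difference of the columns.
  have main : ∀ (π : ℕ → ℕ) (e p : ℕ) (β : ℤ),
      (∀ i, 2 ≤ i → i < n → 1 ≤ π i ∧ π i ≤ n - 1 ∧ π i ≠ c) →
      (∀ i j, 2 ≤ i → i < n → 2 ≤ j → j < n → π i = π j → i = j) →
      0 < e → 0 < p → ((e * a 0 : ℕ) : ℤ) + β = a q → ((s * a q : ℕ) : ℤ) + β = x (π 2) →
      (∀ i, 2 ≤ i → i + 1 < n → (x (π i) : ℤ) + β = x (π (i + 1))) →
      (x (π (n - 1)) : ℤ) + β = (p * a 0 : ℕ) →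
      ∃ σ : Equiv.Perm (Fin n), σ 0 = 0 ∧ ∃ e ℓ p : ℕ, 0 < e ∧ 0 < ℓ ∧ 0 < p ∧
        definingIdeal k (a ∘ σ) = minorsIdeal 2 (curveMatrix k n e ℓ p) := by
    intro π e p β hπ hπinj he hp h0 h1 h2 h3
    have hex : ∀ i : Fin n, ∃ l, (i.val = 0 → l = 0) ∧ (i.val = 1 → l = q) ∧
        (2 ≤ i.val → l ≠ 0 ∧ l ≠ q ∧ a l = x (π i)) := by
      intro i
      rcases Nat.lt_or_ge i.val 2 with hi | hi
      · rcases Nat.eq_zero_or_pos i.val with hi0 | hi0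
        · exact ⟨0, fun _ => rfl, fun _ => by omega, fun _ => by omega⟩
        · exact ⟨q, fun _ => by omega, fun _ => rfl, fun _ => by omega⟩
      · obtain ⟨hπ1, hπn, hπc⟩ := hπ i hi i.2
        obtain ⟨l, hl0, hlq, hl⟩ := hxgen _ hπ1 hπn hπc
        exact ⟨l, fun _ => by omega, fun _ => by omega, fun _ => ⟨hl0, hlq, hl.symm⟩⟩
    choose σ hσ0 hσ1 hσ2 using hex
    have hσinj : Function.Injective σ := by
      have hlow : ∀ i j : Fin n, i.val < 2 → σ i = σ j → i.val = j.val := by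
        intro i j hi hij
        have hi' : i.val = 0 ∨ i.val = 1 := by omega
        rcases Nat.lt_or_ge j.val 2 with hj | hj
        · have hj' : j.val = 0 ∨ j.val = 1 := by omega
          rcases hi' with hi' | hi' <;> rcases hj' with hj' | hj'
          · omega
          · rw [hσ0 i hi', hσ1 j hj'] at hij
            exact absurd hij.symm hq
          · rw [hσ1 i hi', hσ0 j hj'] at hij
            exact absurd hij hq
          · omega
        · rcases hi' with hi' | hi'
          · exact absurd (hij.symm.trans (hσ0 i hi')) (hσ2 j hj).1
          · exact absurd (hij.symm.trans (hσ1 i hi')) (hσ2 j hj).2.1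
      intro i j hij
      apply Fin.ext
      rcases Nat.lt_or_ge i.val 2 with hi | hi
      · exact hlow i j hi hij
      rcases Nat.lt_or_ge j.val 2 with hj | hj
      · exact (hlow j i hj hij.symm).symm
      · refine hπinj i j hi i.2 hj j.2 (hxinj ?_)
        rw [← (hσ2 i hi).2.2, ← (hσ2 j hj).2.2, hij]
    have hs0 : σ 0 = 0 := hσ0 0 rfl
    refine ⟨Equiv.ofBijective σ (Finite.injective_iff_bijective.1 hσinj), hs0, e, s, p, he, hs1,
      hp, ?_⟩
    have hb : a ∘ (Equiv.ofBijective σ (Finite.injective_iff_bijective.1 hσinj)) =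
      fun i => a (σ i) := rfl
    rw [hb]
    have hb0 : a (σ 0) = a 0 := by rw [hs0]
    have hb1 : a (σ ⟨1, by omega⟩) = a q := by rw [hσ1 _ rfl]
    have hb2 : ∀ i : Fin n, 2 ≤ i.val → a (σ i) = x (π i) := fun i hi => (hσ2 i hi).2.2
    have hbA : ∀ i : Fin n, 2 ≤ i.val → IsApery H (a 0) (a (σ i)) := fun i hi => by
      rw [hb2 i hi]
      exact (hxPF _ (hπ i hi i.2).1 (hπ i hi i.2).2.1).1
    refine definingIdeal_eq_minorsIdeal hn _ e s p β (ha0 _) ?_ ?_ ?_ ?_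
    · rintro ⟨i, hin⟩
      simp only [hb0]
      rcases Nat.lt_or_ge i 2 with hi | hi
      · interval_cases i
        · simp only [zero_add, if_true, dif_pos (show 1 < n by omega), hb1]
          exact h0
        · simp only [one_ne_zero, if_false, if_true, Nat.reduceAdd, dif_pos (show 2 < n by omega),
            hb1]
          rw [h1, hb2 _ (by simp)]
      · rw [if_neg (by omega), if_neg (by omega), hb2 _ hi]
        by_cases hlast : i + 1 < n
        · rw [dif_pos hlast, h2 i hi hlast, hb2 _ (by simp; omega)]
        · rw [dif_neg hlast, ← h3, show n - 1 = i by omega]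
    · simp only [hb0, hb1]
      intro i j hi hj hij
      exact hmulinj (hcast ((hsA i).2 hi) ((hsA j).2 hj) ((ZMod.natCast_eq_natCast_iff _ _ _).2 hij))
    · simp only [hb0]
      intro i j hi hj hij
      exact hσinj (hinj (hcast (hbA i hi) (hbA j hj) ((ZMod.natCast_eq_natCast_iff _ _ _).2 hij)))
    · simp only [hb0, hb1]
      intro i hi j hj hij
      exact hmulgen i (σ j) (hσ2 j hj).2.1
        (hcast ((hsA i).2 hi) (hbA j hj) ((ZMod.natCast_eq_natCast_iff _ _ _).2 hij))
  rcases hpart with ⟨hqα, hx0, hcN⟩ | ⟨hqα, hc1', hxn⟩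
  · obtain ⟨e, he⟩ : a 0 ∣ a q + α := by
      rw [← ZMod.natCast_eq_zero_iff, Nat.cast_add, hqα, neg_add_cancel]
    obtain ⟨p, hp⟩ : a 0 ∣ h + a 0 := (ZMod.natCast_eq_zero_iff _ _).1 hx0
    have hxs : ∀ i j, j + 1 = i → (x i : ℤ) + -(α : ℤ) = x j := by
      rintro _ j rfl
      rw [hxsucc]; push_cast; ring
    -- Here `s * a q` is the last term, so the progression is run downwards, ending at `x 0 = h + a
    -- 0 = p * a 0`.
    refine main (fun i => n - i) e p (-α) (fun i hi hin => by omega)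
      (fun i j hi hin hj hjn hij => by omega)
      (Nat.pos_of_ne_zero ?_) (Nat.pos_of_ne_zero ?_) ?_ ?_ ?_ ?_
    · rintro rfl; omega
    · rintro rfl
      have := ha0 0
      omega
    · rw [mul_comm e, ← he]; push_cast; ring
    · rw [← hxc]
      exact hxs _ _ (by omega)
    · intro i hi hin
      exact hxs _ _ (by omega)
    · rw [mul_comm p, ← hp, hxs _ 0 (by omega)]
      simp [hx]
  · subst hc1'
    have hdvd : (a q : ZMod (a 0)) = (α : ZMod (a 0)) := hqα
    obtain ⟨p, hp⟩ : a 0 ∣ x n := by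
      rw [← ZMod.natCast_eq_zero_iff, hxcast, ← hxn, show n - 1 + 1 = n by omega]
    -- Needed for `e > 0`. Otherwise `α = a q + t * a 0`, and the generator `x 2 = s * a q + α`
    -- would decompose.
    have hαq : α < a q := by
      by_contra hcon
      obtain ⟨t, ht⟩ := (Nat.modEq_iff_dvd' (not_lt.1 hcon)).1
        ((ZMod.natCast_eq_natCast_iff _ _ _).1 hdvd)
      obtain ⟨l, -, -, hl⟩ := hxgen 2 (by omega) (by omega) (by omega)
      refine hirr l (a q) (hmem q) (s • a q + t • a 0)
        (add_mem (nsmul_mem (hmem q) s) (nsmul_mem (hmem 0) t)) (ha0 q)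
        (by simp only [smul_eq_mul]; positivity) ?_
      rw [← hl, hxsucc, hxc, smul_eq_mul, smul_eq_mul, mul_comm t]
      omega
    obtain ⟨e, he⟩ := (Nat.modEq_iff_dvd' hαq.le).1
      ((ZMod.natCast_eq_natCast_iff _ _ _).1 hdvd.symm)
    -- Here `s * a q` is the first term, so the progression is run upwards, ending at `x n = p * a
    -- 0`.
    refine main id e p α (fun i hi hin => by simp only [id]; omega)
      (fun i j hi hin hj hjn hij => hij)
      (Nat.pos_of_ne_zero ?_) (Nat.pos_of_ne_zero ?_) ?_ ?_ ?_ ?_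
    · rintro rfl; omega
    · rintro rfl
      have := ha0 0
      simp only [hx] at hp
      omega
    · rw [mul_comm e, ← he]; omega
    · have hx2 : x 2 = x 1 + α := hxsucc 1
      rw [← hxc, id, hx2]; push_cast; ring
    · intro i hi hin
      rw [id, id, hxsucc]; push_cast; ring
    · rw [mul_comm p, ← hp, id]
      have := hxsucc (n - 1)
      rw [show n - 1 + 1 = n by omega] at this
      rw [this]; push_cast; ring
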